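/- Let $r$ be odd. A half-set of $\mathbb{Z}_r$ is a set $L\subseteq\mathbb{Z}_r$ of $(r-1)/2$ nonzero elements that contains exactly one of $x,-x$ for every nonzero $x\in\mathbb{Z}_r$. A Heffter system $D(r,k)$ is a partition of a half-set of $\mathbb{Z}_r$ into parts of size $k$, each of which has sum $0$ in $\mathbb{Z}_r$. A Heffter array $H(m,n)$ is an $m\times n$ array with entries in $\mathbb{Z}_{2mn+1}$ whose rows form a Heffter system $D(2mn+1,n)$ and whose columns form a Heffter system $D(2mn+1,m)$ on the same half-set. An ordering $(a_1,\dots,a_k)$ of the elements of a part is simple if its partial sums $s_i=a_1+\cdots+a_i$ $(1\le i\le k)$ are pairwise distinct in $\mathbb{Z}_r$. A Heffter system is simple if each of its parts has a simple ordering, and a Heffter array is simple if its row and column Heffter systems are simple. **Theorem.** For every integer $n\ge 3$ there exists a simple Heffter array $H(3,n)$. Moreover, it can be chosen so that the natural orderings are themselves simple: in each row, read from left to right, the $n$ partial sums are pairwise distinct modulo $6n+1$, and in each column, read from top to bottom, the $3$ partial sums are pairwise distinct modulo $6n+1$. -/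

import Mathlib

/-- A half-set of `ℤ_r` (`r` odd): `(r - 1) / 2` nonzero elements, exactly one of `x`, `-x` for
every nonzero `x`. -/
structure IsHalfSet {r : ℕ} (L : Finset (ZMod r)) : Prop where
  card_eq : 2 * L.card + 1 = r
  zero_notMem : (0 : ZMod r) ∉ L
  mem_xor_neg_mem : ∀ x : ZMod r, x ≠ 0 → Xor (x ∈ L) (-x ∈ L)

/-- `D` is a Heffter system `D(r, k)` on `L`: a partition of the half-set `L` of `ℤ_r` into parts
of size `k`, each part having sum `0` in `ℤ_r`. -/
structure IsHeffterSystem {r : ℕ} (k : ℕ) (L : Finset (ZMod r)) (D : Finset (Finset (ZMod r))) :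
    Prop where
  isHalfSet : IsHalfSet L
  disjoint_parts : ∀ P ∈ D, ∀ Q ∈ D, P ≠ Q → Disjoint P Q
  union_parts : D.biUnion id = L
  card_part : ∀ P ∈ D, P.card = k
  sum_part : ∀ P ∈ D, ∑ x ∈ P, x = 0

/-- The sequence `a` lists the elements of `A`, each exactly once. -/
def IsOrderingOf {r k : ℕ} (a : Fin k → ZMod r) (A : Finset (ZMod r)) : Prop :=
  Function.Injective a ∧ Finset.univ.image a = A

/-- The partial sum `a₁ + ⋯ + aᵢ`, with `aᵢ` included. -/
def partialSum {r k : ℕ} (a : Fin k → ZMod r) (i : Fin k) : ZMod r :=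
  ∑ j ∈ Finset.Iic i, a j

/-- An ordering is simple if its partial sums are pairwise distinct. -/
def IsSimpleOrdering {r k : ℕ} (a : Fin k → ZMod r) : Prop :=
  ∀ i j : Fin k, i ≠ j → partialSum a i ≠ partialSum a j

/-- Each part of `D` has a simple ordering. -/
def HasSimpleOrderings {r : ℕ} (k : ℕ) (D : Finset (Finset (ZMod r))) : Prop :=
  ∀ P ∈ D, ∃ a : Fin k → ZMod r, IsOrderingOf a P ∧ IsSimpleOrdering a

/-- The parts given by the rows of an array. -/
def rowParts {r m n : ℕ} (H : Matrix (Fin m) (Fin n) (ZMod r)) : Finset (Finset (ZMod r)) :=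
  Finset.univ.image fun i : Fin m => Finset.univ.image fun j : Fin n => H i j

/-- The parts given by the columns of an array. -/
def colParts {r m n : ℕ} (H : Matrix (Fin m) (Fin n) (ZMod r)) : Finset (Finset (ZMod r)) :=
  Finset.univ.image fun j : Fin n => Finset.univ.image fun i : Fin m => H i j

/-- A Heffter array `H(m, n)`: an `m × n` array over `ℤ_{2mn+1}` whose rows form a Heffter system
`D(2mn + 1, n)` and whose columns form a Heffter system `D(2mn + 1, m)`, on the same half-set. -/
def IsHeffterArray {m n : ℕ} (H : Matrix (Fin m) (Fin n) (ZMod (2 * m * n + 1))) : Prop :=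
  ∃ L : Finset (ZMod (2 * m * n + 1)),
    IsHeffterSystem n L (rowParts H) ∧ IsHeffterSystem m L (colParts H)

/-- A Heffter array is simple if its row and column Heffter systems are simple. -/
def IsSimpleHeffterArray {m n : ℕ} (H : Matrix (Fin m) (Fin n) (ZMod (2 * m * n + 1))) : Prop :=
  IsHeffterArray H ∧ HasSimpleOrderings n (rowParts H) ∧ HasSimpleOrderings m (colParts H)

/-! ### Heffter systems coming from an array -/

/-! The array is explicit. Only three properties need work: the entries meet every pair `x`, `-x` of
nonzero residues, rows and columns sum to zero, and row partial sums are distinct. An array has `3n`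
entries for `3n` such pairs, so meeting every pair already forces the entries to be distinct and to
form a half-set (`CoversNonzero.injective_and_isHalfSet`). Columns of length three are then simple
automatically (`isSimpleOrdering_three`).

For each residue of `n` modulo 4 there are 3 to 6 initial columns followed by `t` blocks of four
columns, with entries linear in `t` and the block index `r`. Over one block each row gains a
constant modulo `N = 6n + 1`: 1 in two rows and -2 in the third, or the negatives. So the partial
sums at a fixed position in the block form an arithmetic progression in `r` of difference ±1 or ±2.
Within a row, the four progressions lie in disjoint intervals of `[0, N)`. Everything becomes linear
arithmetic (`exists_simpleHeffterArray_of_rows`). -/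

/-- The entries of an array, together with their negatives, exhaust the nonzero elements. -/
def CoversNonzero {r : ℕ} {ι : Type*} (h : ι → ZMod r) : Prop :=
  ∀ x : ZMod r, x ≠ 0 → ∃ p, h p = x ∨ h p = -x

/-- If at most half of the nonzero elements cover all of them up to sign, they form a half-set and
are listed without repetition. -/
theorem CoversNonzero.injective_and_isHalfSet {r : ℕ} [NeZero r] {ι : Type*} [Fintype ι]
    {h : ι → ZMod r} (hcov : CoversNonzero h) (hcard : 2 * Fintype.card ι + 1 = r) :
    Function.Injective h ∧ IsHalfSet (Finset.univ.image h) := by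
  classical
  set L := Finset.univ.image h with hL
  set M := L.image (fun x => -x) with hM
  have hM_card : M.card = L.card := Finset.card_image_of_injective _ neg_injective
  have hsub : Finset.univ.erase (0 : ZMod r) ⊆ L ∪ M := by
    intro x hx
    obtain ⟨p, hp | hp⟩ := hcov x (Finset.ne_of_mem_erase hx)
    · exact Finset.mem_union_left _ (Finset.mem_image.2 ⟨p, Finset.mem_univ _, hp⟩)
    · refine Finset.mem_union_right _ (Finset.mem_image.2
        ⟨h p, Finset.mem_image_of_mem _ (Finset.mem_univ _), ?_⟩)
      rw [hp, neg_neg]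
  have h1 : r - 1 ≤ (L ∪ M).card := by
    have := Finset.card_le_card hsub
    rwa [Finset.card_erase_of_mem (Finset.mem_univ _), Finset.card_univ, ZMod.card] at this
  have h2 : L.card ≤ Fintype.card ι := Finset.card_image_le
  have h3 := Finset.card_union_add_card_inter L M
  -- Equality holds throughout `r - 1 ≤ |L ∪ M| ≤ |L| + |M| ≤ 2|ι| = r - 1`. This gives both
  -- injectivity and `L ∩ M = ∅`.
  have hLcard : L.card = Fintype.card ι := by omega
  have hinter : L ∩ M = ∅ := Finset.card_eq_zero.1 (by omega)
  have hneg : ∀ x ∈ L, -x ∉ L := by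
    intro x hx hx'
    have : x ∈ L ∩ M := Finset.mem_inter.2 ⟨hx, Finset.mem_image.2 ⟨-x, hx', neg_neg x⟩⟩
    simp [hinter] at this
  refine ⟨fun p q e => Finset.card_image_iff.1 hLcard (Finset.mem_univ p) (Finset.mem_univ q) e, ?_, ?_, ?_⟩
  · omega
  · intro h0
    exact hneg 0 h0 (by simpa using h0)
  · intro x hx
    obtain ⟨p, hp | hp⟩ := hcov x hx
    · have hxL : x ∈ L := Finset.mem_image.2 ⟨p, Finset.mem_univ _, hp⟩
      exact Or.inl ⟨hxL, hneg x hxL⟩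
    · have hxL : -x ∈ L := Finset.mem_image.2 ⟨p, Finset.mem_univ _, hp⟩
      exact Or.inr ⟨hxL, fun hx' => hneg x hx' hxL⟩

/-- The lines of an array without repeated entries form a Heffter system when the lines sum to
zero. -/
theorem isHeffterSystem_lines {r a k : ℕ} {h : Fin a → Fin k → ZMod r}
    (hinj : ∀ i j i' j', h i j = h i' j' → i = i' ∧ j = j') {L : Finset (ZMod r)}
    (hL : IsHalfSet L) (hmem : ∀ x, x ∈ L ↔ ∃ i j, h i j = x) (hsum : ∀ i, ∑ j, h i j = 0) :
    IsHeffterSystem k L (Finset.univ.image fun i => Finset.univ.image fun j => h i j) where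
  isHalfSet := hL
  disjoint_parts := by
    simp only [Finset.mem_image, Finset.mem_univ, true_and, forall_exists_index,
      forall_apply_eq_imp_iff]
    intro i i' hne
    rw [Finset.disjoint_left]
    intro x hx hx'
    simp only [Finset.mem_image, Finset.mem_univ, true_and] at hx hx'
    obtain ⟨j, rfl⟩ := hx
    obtain ⟨j', hj'⟩ := hx'
    exact hne (by rw [(hinj _ _ _ _ hj').1])
  union_parts := by
    ext x
    simp [hmem]
  card_part := by
    simp only [Finset.mem_image, Finset.mem_univ, true_and, forall_exists_index,
      forall_apply_eq_imp_iff]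
    intro i
    rw [Finset.card_image_of_injective _ fun j j' e => (hinj _ _ _ _ e).2]
    simp
  sum_part := by
    simp only [Finset.mem_image, Finset.mem_univ, true_and, forall_exists_index,
      forall_apply_eq_imp_iff]
    intro i
    rw [Finset.sum_image fun j _ j' _ e => (hinj _ _ _ _ e).2]
    exact hsum i

theorem hasSimpleOrderings_lines {r a k : ℕ} {h : Fin a → Fin k → ZMod r}
    (hinj : ∀ i j i' j', h i j = h i' j' → i = i' ∧ j = j')
    (hsimple : ∀ i, IsSimpleOrdering (h i)) :
    HasSimpleOrderings k (Finset.univ.image fun i => Finset.univ.image fun j => h i j) := by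
  intro P hP
  obtain ⟨i, -, rfl⟩ := Finset.mem_image.1 hP
  exact ⟨h i, ⟨fun j j' e => (hinj _ _ _ _ e).2, rfl⟩, hsimple i⟩

/-- The partial sums are `a 0`, `-a 2` and `0`; any two of them differ by an entry up to sign, and
entries are nonzero. -/
theorem isSimpleOrdering_three {r : ℕ} {a : Fin 3 → ZMod r} (h0 : ∀ i, a i ≠ 0)
    (hsum : ∑ i, a i = 0) : IsSimpleOrdering a := by
  have e0 : partialSum a 0 = a 0 := by
    rw [partialSum, show Finset.Iic (0 : Fin 3) = {0} by decide]; simp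
  have e1 : partialSum a 1 = a 0 + a 1 := by
    rw [partialSum, show Finset.Iic (1 : Fin 3) = {0, 1} by decide]; simp
  have e2 : partialSum a 2 = 0 := by
    rw [← hsum, partialSum, show Finset.Iic (2 : Fin 3) = Finset.univ by decide]
  have hs : a 0 + a 1 = -a 2 := by
    rw [Fin.sum_univ_three] at hsum
    exact eq_neg_of_add_eq_zero_left hsum
  have hlt : ∀ i j : Fin 3, i < j → partialSum a i ≠ partialSum a j := by
    intro i j hij
    fin_cases i <;> fin_cases j <;> simp at hij <;> simp [e0, e1, e2, h0, hs]
    simpa [hs] using fun e : a 0 = -a 2 => h0 1 (by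
      have := hs; rw [e] at this; simpa using this)
  intro i j hij
  rcases lt_or_gt_of_ne hij with h | h
  · exact hlt i j h
  · exact (hlt j i h).symm

/-- An array whose entries cover the nonzero residues up to sign, whose columns sum to zero and
whose rows sum to zero with distinct partial sums is a simple Heffter array. -/
theorem isSimpleHeffterArray_of_covers {n : ℕ}
    (H : Matrix (Fin 3) (Fin n) (ZMod (2 * 3 * n + 1)))
    (hcov : CoversNonzero fun p : Fin 3 × Fin n => H p.1 p.2)
    (hrow : ∀ i, ∑ j, H i j = 0) (hcol : ∀ j, ∑ i, H i j = 0)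
    (hsimple : ∀ i : Fin 3, IsSimpleOrdering fun j : Fin n => H i j) :
    IsSimpleHeffterArray H ∧ (∀ i : Fin 3, IsSimpleOrdering fun j : Fin n => H i j) ∧
      ∀ j : Fin n, IsSimpleOrdering fun i : Fin 3 => H i j := by
  obtain ⟨hinj, hL⟩ := hcov.injective_and_isHalfSet (by simp; ring)
  have hinj' : ∀ i j i' j', H i j = H i' j' → i = i' ∧ j = j' := fun i j i' j' e =>
    Prod.mk.inj (hinj (a₁ := (i, j)) (a₂ := (i', j')) e)
  have hcolsimple : ∀ j : Fin n, IsSimpleOrdering fun i : Fin 3 => H i j := fun j =>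
    isSimpleOrdering_three (fun i e => hL.zero_notMem
      (Finset.mem_image.2 ⟨(i, j), Finset.mem_univ _, e⟩)) (hcol j)
  refine ⟨⟨⟨_, isHeffterSystem_lines hinj' hL (by simp) hrow,
    isHeffterSystem_lines (h := fun j i => H i j)
      (fun j i j' i' e => (hinj' i j i' j' e).symm) hL (fun x => ?_) hcol⟩,
    hasSimpleOrderings_lines hinj' hsimple,
    hasSimpleOrderings_lines (h := fun j i => H i j)
      (fun j i j' i' e => (hinj' i j i' j' e).symm) hcolsimple⟩, hsimple, hcolsimple⟩
  simpa using exists_comm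

/-- Every residue modulo `6n + 1` has a representative of absolute value at most `3n`, so it
suffices that the integer entries realise `1, …, 3n` up to sign. -/
theorem CoversNonzero.of_int {n : ℕ} {ι : Type*} (f : ι → ℤ)
    (hf : ∀ v : ℤ, 1 ≤ v → v ≤ 3 * n → ∃ p, f p = v ∨ f p = -v) :
    CoversNonzero fun p => ((f p : ℤ) : ZMod (2 * 3 * n + 1)) := by
  intro x hx
  have hx0 : x.valMinAbs ≠ 0 := by simpa [ZMod.valMinAbs_eq_zero] using hx
  have hle : x.valMinAbs.natAbs ≤ (2 * 3 * n + 1) / 2 := ZMod.natAbs_valMinAbs_le x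
  obtain ⟨p, hp⟩ := hf x.valMinAbs.natAbs (by omega) (by omega)
  refine ⟨p, ?_⟩
  have hp' : f p = x.valMinAbs ∨ f p = -x.valMinAbs := by omega
  rcases hp' with h | h
  · left; simp [h]
  · right; simp [h]

/-! ### Partial sums of integer sequences -/

/-- If `S` agrees modulo `N` with the partial sums of `f`, takes values in `[0, N)` and is
injective, then the residues of `f` sum to zero and have distinct partial sums. -/
theorem sum_eq_zero_and_isSimpleOrdering {n N : ℕ} (hn : 0 < n) (f S : ℕ → ℤ) (hS0 : S 0 = 0)
    (hstep : ∀ j < n, (S (j + 1) : ZMod N) = S j + f j) (hSn : (S n : ZMod N) = 0)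
    (hrange : ∀ j < n, 0 ≤ S j ∧ S j < N) (hinj : ∀ j < n, ∀ l < n, S j = S l → j = l) :
    ∑ j : Fin n, ((f j : ℤ) : ZMod N) = 0 ∧
      IsSimpleOrdering fun j : Fin n => ((f j : ℤ) : ZMod N) := by
  have hsum : ∀ j ≤ n, ∑ l ∈ Finset.range j, ((f l : ℤ) : ZMod N) = S j := by
    intro j
    induction j with
    | zero => simp [hS0]
    | succ j ih => intro hj; rw [Finset.sum_range_succ, ih (by omega), hstep j (by omega)]
  have hpartial : ∀ i : Fin n, partialSum (fun j : Fin n => ((f j : ℤ) : ZMod N)) i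
      = S (i + 1) := by
    intro i
    rw [← hsum (i + 1) (by omega), partialSum]
    refine Finset.sum_bij (fun j _ => (j : ℕ)) ?_ ?_ ?_ ?_
    · intro j hj; simp only [Finset.mem_Iic] at hj; simp; omega
    · intro j _ l _ e; exact Fin.ext e
    · intro l hl
      simp only [Finset.mem_range] at hl
      exact ⟨⟨l, by omega⟩, by simp [Fin.le_def]; omega, rfl⟩
    · intro j _; rfl
  have hmod : ∀ j < n, ∀ l < n, (S j : ZMod N) = S l → j = l := by
    intro j hj l hl e
    rw [ZMod.intCast_eq_intCast_iff] at e
    refine hinj j hj l hl ?_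
    have := e.eq
    rwa [Int.emod_eq_of_lt (hrange j hj).1 (hrange j hj).2,
      Int.emod_eq_of_lt (hrange l hl).1 (hrange l hl).2] at this
  refine ⟨?_, ?_⟩
  · rw [Fin.sum_univ_eq_sum_range (fun j => ((f j : ℤ) : ZMod N)), hsum n le_rfl, hSn]
  -- The partial sums are `S 1, …, S n`, while distinctness is known for `S 0, …, S (n - 1)`. Since
  -- `S n` vanishes modulo `N` like `S 0`, the two lists agree up to a cyclic shift.
  · have hwrap : ∀ i : Fin n, ∃ j < n, (S (i + 1) : ZMod N) = S j ∧
        (j = i + 1 ∨ (j = 0 ∧ (i : ℕ) + 1 = n)) := by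
      intro i
      rcases Nat.lt_or_ge (i + 1) n with h | h
      · exact ⟨i + 1, h, rfl, Or.inl rfl⟩
      · have hi : (i : ℕ) + 1 = n := by omega
        exact ⟨0, hn, by exact_mod_cast (by rw [hi, hSn, hS0, Int.cast_zero] : (S (i + 1) : ZMod N) = S 0), Or.inr ⟨rfl, hi⟩⟩
    intro i j hij e
    rw [hpartial, hpartial] at e
    obtain ⟨i', hi', ei, hi⟩ := hwrap i
    obtain ⟨j', hj', ej, hj⟩ := hwrap j
    have := hmod i' hi' j' hj' (by rw [← ei, ← ej, e])
    exact hij (Fin.ext (by omega))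

/-! ### Sequences made of an initial part followed by blocks of length four -/

/-- The sequence that starts with `b` and continues with the blocks `g 0`, `g 1`, … -/
def blockSeq {c : ℕ} (b : Fin c → ℤ) (g : ℤ → Fin 4 → ℤ) (j : ℕ) : ℤ :=
  if h : j < c then b ⟨j, h⟩ else g ((j - c) / 4 : ℕ) ⟨(j - c) % 4, Nat.mod_lt _ (by norm_num)⟩

theorem blockSeq_initial {c : ℕ} (b : Fin c → ℤ) (g : ℤ → Fin 4 → ℤ) (j : Fin c) :
    blockSeq b g j = b j := by
  simp [blockSeq]

theorem blockSeq_block {c : ℕ} (b : Fin c → ℤ) (g : ℤ → Fin 4 → ℤ) (r : ℕ) (k : Fin 4) :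
    blockSeq b g (c + 4 * r + k) = g r k := by
  have h1 : (c + 4 * r + k - c) / 4 = r := by omega
  have h2 : (c + 4 * r + k - c) % 4 = k := by omega
  rw [blockSeq, dif_neg (by omega)]
  simp only [h1, h2]

theorem exists_initial_or_block {c t j : ℕ} (hj : j < 4 * t + c) :
    (∃ i : Fin c, j = i) ∨ ∃ r < t, ∃ k : Fin 4, j = c + 4 * r + k := by
  rcases Nat.lt_or_ge j c with h | h
  · exact Or.inl ⟨⟨j, h⟩, rfl⟩
  · exact Or.inr ⟨(j - c) / 4, by omega, ⟨(j - c) % 4, by omega⟩, by simp only; omega⟩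

/-- `x` is one of `0`, `N`, `-N`. -/
def IsSmallMultiple (N x : ℤ) : Prop := x = 0 ∨ x = N ∨ x = -N

theorem IsSmallMultiple.cast_eq_zero {N : ℕ} {x : ℤ} (h : IsSmallMultiple N x) :
    (x : ZMod N) = 0 := by
  rcases h with h | h | h <;> simp [h]

/-- `B` and `G` list, modulo `N`, the sums of the terms preceding each term of the sequence with
initial part `b` and blocks `g`; they are distinct in `[0, N)`, and the total sum is zero. -/
structure IsSimpleRow {c : ℕ} (t N : ℤ) (b B : Fin (c + 1) → ℤ) (g G : ℤ → Fin 4 → ℤ) :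
    Prop where
  initial_zero : B 0 = 0
  initial_succ : ∀ j : Fin c, IsSmallMultiple N (B j.succ - B j.castSucc - b j.castSucc)
  block_zero : IsSmallMultiple N (G 0 0 - B (Fin.last c) - b (Fin.last c))
  block_succ : ∀ r, ∀ k : Fin 3, IsSmallMultiple N (G r k.succ - G r k.castSucc - g r k.castSucc)
  block_next : ∀ r, IsSmallMultiple N (G (r + 1) 0 - G r 3 - g r 3)
  block_end : IsSmallMultiple N (G t 0)
  initial_range : ∀ j, 0 ≤ B j ∧ B j < N
  block_range : ∀ r, 0 ≤ r → r < t → ∀ k, 0 ≤ G r k ∧ G r k < N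
  initial_injective : ∀ j l, j < l → B j ≠ B l
  initial_ne_block : ∀ r, 0 ≤ r → r < t → ∀ j k, B j ≠ G r k
  block_injective : ∀ r s, 0 ≤ r → r < t → 0 ≤ s → s < t → ∀ k, G r k = G s k → r = s
  block_ne_block : ∀ r s, 0 ≤ r → r < t → 0 ≤ s → s < t → ∀ k l, k < l → G r k ≠ G s l

theorem IsSimpleRow.sum_eq_zero_and_isSimpleOrdering {c t n N : ℕ} {b B : Fin (c + 1) → ℤ}
    {g G : ℤ → Fin 4 → ℤ} (h : IsSimpleRow t N b B g G) (hn : n = 4 * t + (c + 1)) :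
    ∑ j : Fin n, ((blockSeq b g j : ℤ) : ZMod N) = 0 ∧
      IsSimpleOrdering fun j : Fin n => ((blockSeq b g j : ℤ) : ZMod N) := by
  have hcast : ∀ {x y z : ℤ}, IsSmallMultiple N (x - y - z) → (x : ZMod N) = y + z := by
    intro x y z hx
    have := hx.cast_eq_zero
    push_cast at this
    linear_combination this
  -- This is the value on entering block `r`, used at both kinds of junction: initial part to block,
  -- and block to block. At `r = t` it is the total sum of the row.
  have hstart : ∀ r : ℕ, blockSeq B G (c + 1 + 4 * r) = G r 0 := fun r => blockSeq_block B G r 0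
  refine _root_.sum_eq_zero_and_isSimpleOrdering (by omega) (blockSeq b g) (blockSeq B G)
    ?_ ?_ ?_ ?_ ?_
  · exact (blockSeq_initial B G 0).trans h.initial_zero
  · intro j hj
    rw [hn] at hj
    rcases exists_initial_or_block hj with ⟨i, rfl⟩ | ⟨r, hr, k, rfl⟩
    · rw [blockSeq_initial, blockSeq_initial]
      induction i using Fin.lastCases with
      | last =>
        have := hstart 0
        simp only [Fin.val_last, mul_zero, add_zero, Nat.cast_zero] at this ⊢
        rw [this]
        exact hcast h.block_zero
      | cast i =>
        have := blockSeq_initial B G i.succ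
        simp only [Fin.val_succ, Fin.val_castSucc] at this ⊢
        rw [this]
        exact hcast (h.initial_succ i)
    · rw [blockSeq_block, blockSeq_block]
      induction k using Fin.lastCases with
      | last =>
        have := hstart (r + 1)
        rw [show c + 1 + 4 * r + (Fin.last 3 : Fin 4) + 1 = c + 1 + 4 * (r + 1) by simp; ring,
          this]
        push_cast
        exact hcast (h.block_next r)
      | cast k =>
        have := blockSeq_block B G r k.succ
        simp only [Fin.val_succ, Fin.val_castSucc, ← add_assoc] at this ⊢
        rw [this]
        exact hcast (h.block_succ r k)
  · rw [hn, show 4 * t + (c + 1) = c + 1 + 4 * t by ring, hstart]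
    exact h.block_end.cast_eq_zero
  · intro j hj
    rw [hn] at hj
    rcases exists_initial_or_block hj with ⟨i, rfl⟩ | ⟨r, hr, k, rfl⟩
    · rw [blockSeq_initial]
      exact h.initial_range i
    · rw [blockSeq_block]
      exact h.block_range r (by omega) (by omega) k
  · intro j hj l hl e
    rw [hn] at hj hl
    rcases exists_initial_or_block hj with ⟨i, rfl⟩ | ⟨r, hr, k, rfl⟩ <;>
      rcases exists_initial_or_block hl with ⟨i', rfl⟩ | ⟨s, hs, k', rfl⟩ <;>
      simp only [blockSeq_initial, blockSeq_block] at e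
    · rcases lt_trichotomy i i' with hi | hi | hi
      · exact absurd e (h.initial_injective _ _ hi)
      · rw [hi]
      · exact absurd e.symm (h.initial_injective _ _ hi)
    · exact absurd e (h.initial_ne_block s (by omega) (by omega) _ _)
    · exact absurd e.symm (h.initial_ne_block r (by omega) (by omega) _ _)
    · rcases lt_trichotomy k k' with hk | hk | hk
      · exact absurd e (h.block_ne_block r s (by omega) (by omega) (by omega) (by omega) _ _ hk)
      · subst hk
        have := h.block_injective r s (by omega) (by omega) (by omega) (by omega) _ e
        omega
      · exact absurd e.symm
          (h.block_ne_block s r (by omega) (by omega) (by omega) (by omega) _ _ hk)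

/-! ### Assembling an array from three rows -/

/-- `v` or `-v` is an entry of one of the initial columns `b` or of the first `t` blocks `g`. -/
def IsEntry {c : ℕ} (t : ℤ) (b : Fin 3 → Fin c → ℤ) (g : Fin 3 → ℤ → Fin 4 → ℤ) (v : ℤ) : Prop :=
  (∃ i j, b i j = v ∨ b i j = -v) ∨
    ∃ i r k, (0 ≤ r ∧ r < t) ∧ (g i r k = v ∨ g i r k = -v)

/-- With `n = 4t + c + 1`, the modulus `6n + 1` is `24t + 6c + 7` and the largest absolute value
needed, `3n`, is `12t + 3c + 3`. The hypotheses mention only integers, so for concrete linear data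
`omega` can decide them. -/
theorem exists_simpleHeffterArray_of_rows {c t n : ℕ} (hn : n = 4 * t + (c + 1))
    (b B : Fin 3 → Fin (c + 1) → ℤ) (g G : Fin 3 → ℤ → Fin 4 → ℤ)
    (hrow : ∀ i, IsSimpleRow t (24 * t + (6 * c + 7)) (b i) (B i) (g i) (G i))
    (hb : ∀ j, IsSmallMultiple (24 * t + (6 * c + 7)) (b 0 j + b 1 j + b 2 j))
    (hg : ∀ r k, IsSmallMultiple (24 * t + (6 * c + 7)) (g 0 r k + g 1 r k + g 2 r k))
    (hentry : ∀ v : ℤ, 1 ≤ v → v ≤ 12 * t + (3 * c + 3) → IsEntry t b g v) :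
    ∃ H : Matrix (Fin 3) (Fin n) (ZMod (2 * 3 * n + 1)),
      IsSimpleHeffterArray H ∧
      (∀ i : Fin 3, IsSimpleOrdering fun j : Fin n => H i j) ∧
      (∀ j : Fin n, IsSimpleOrdering fun i : Fin 3 => H i j) := by
  have hN : (24 * t + (6 * c + 7) : ℤ) = (2 * 3 * n + 1 : ℕ) := by rw [hn]; push_cast; ring
  rw [hN] at hrow hb hg
  refine ⟨fun i j => ((blockSeq (b i) (g i) j : ℤ) : ZMod (2 * 3 * n + 1)),
    isSimpleHeffterArray_of_covers _
    (CoversNonzero.of_int (fun p : Fin 3 × Fin n => blockSeq (b p.1) (g p.1) p.2) ?_)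
    (fun i => ((hrow i).sum_eq_zero_and_isSimpleOrdering hn).1) ?_
    (fun i => ((hrow i).sum_eq_zero_and_isSimpleOrdering hn).2)⟩
  · intro v hv hv'
    rcases hentry v hv (by rw [hn] at hv'; push_cast at hv'; omega) with
      ⟨i, j, h⟩ | ⟨i, r, k, ⟨hr, hrt⟩, h⟩
    · exact ⟨(i, ⟨j, by omega⟩), by simpa [blockSeq_initial] using h⟩
    · lift r to ℕ using hr
      refine ⟨(i, ⟨c + 1 + 4 * r + k, by omega⟩), ?_⟩
      simpa only [blockSeq_block] using h
  · intro j
    rw [Fin.sum_univ_three]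
    rcases exists_initial_or_block (j.isLt.trans_eq hn) with ⟨i, hi⟩ | ⟨r, hr, k, hi⟩
    · simp only [hi, blockSeq_initial]
      exact_mod_cast (hb i).cast_eq_zero
    · simp only [hi, blockSeq_block]
      exact_mod_cast (hg r k).cast_eq_zero

/-! ### The four families of arrays

In each family the arguments are the initial columns, the residues in `[0, N)` of the sums preceding
each of their entries, and the same data for the blocks of four columns, linear in `t` and `r`. The
absolute values of the entries are then found in increasing order. -/

set_option maxHeartbeats 1000000 in
theorem exists_simpleHeffterArray_four_mul_add_three (t : ℕ) :
    ∃ H : Matrix (Fin 3) (Fin (4 * t + 3)) (ZMod (2 * 3 * (4 * t + 3) + 1)),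
      IsSimpleHeffterArray H ∧
      (∀ i : Fin 3, IsSimpleOrdering fun j : Fin (4 * t + 3) => H i j) ∧
      (∀ j : Fin (4 * t + 3), IsSimpleOrdering fun i : Fin 3 => H i j) := by
  refine exists_simpleHeffterArray_of_rows (c := 2) (t := t) rfl
    ![![-1, 9 * t + 6, -7 * t - 5],
      ![-9 * t - 7, 4 * t + 4, 4 * t + 3],
      ![9 * t + 8, 11 * t + 9, 3 * t + 2]]
    ![![0, 24 * t + 18, 9 * t + 5],
      ![0, 15 * t + 12, 19 * t + 16],
      ![0, 9 * t + 8, 20 * t + 17]]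
    -- In each block column the coefficients of `r` are 1, 1, -2 in some order, up to a common sign,
    -- so column sums do not depend on `r`. In each row they cancel over the block, so the gain per
    -- block is constant.
    ![fun r => ![-5 * t - 4 + r, 3 * t + 1 - r, 8 * t + 6 + r, -6 * t - 5 - r],
      fun r => ![3 * t + 3 + r, 12 * t + 9 - r, 11 * t + 8 - 2 * r, -2 * t + 2 * r],
      fun r => ![2 * t + 1 - 2 * r, 9 * t + 9 + 2 * r, 5 * t + 5 + r, 8 * t + 5 - r]]
    ![fun r => ![2 * t - 2 * r, 21 * t + 15 - r, 24 * t + 16 - 2 * r, 8 * t + 3 - r],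
      fun r => ![23 * t + 19 + r, 2 * t + 3 + 2 * r, 14 * t + 12 + r, t + 1 - r],
      fun r => ![23 * t + 19 + r, t + 1 - r, 10 * t + 10 + r, 15 * t + 15 + 2 * r]] ?_ ?_ ?_ ?_
  · intro i
    fin_cases i <;> constructor <;>
      simp [Fin.forall_fin_succ, IsSmallMultiple, -not_lt, -not_le] <;> omega
  · simp [Fin.forall_fin_succ, IsSmallMultiple]; omega
  · simp [Fin.forall_fin_succ, IsSmallMultiple]; omega
  · intro v h1 h2
    rcases lt_or_ge v 2 with h | h
    · exact .inl ⟨0, 0, by simp; omega⟩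
    rcases lt_or_ge v (2 * t + 2) with h | h
    -- Two entries with coefficient ±2 share this interval of length `2t`, one taking each parity.
    -- The witness `r` solves the entry's formula for `v`.
    · rcases Int.emod_two_eq_zero_or_one (v - 2 * t) with h3 | h3
      · exact .inr ⟨1, (2 * t - v) / 2, 3, by omega, by simp; omega⟩
      · exact .inr ⟨2, (2 * t + 1 - v) / 2, 0, by omega, by simp; omega⟩
    rcases lt_or_ge v (3 * t + 2) with h | h
    · exact .inr ⟨0, 3 * t + 1 - v, 1, by omega, by simp⟩
    rcases lt_or_ge v (3 * t + 3) with h | h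
    · exact .inl ⟨2, 2, by simp; omega⟩
    rcases lt_or_ge v (4 * t + 3) with h | h
    · exact .inr ⟨1, v - 3 * t - 3, 0, by omega, by simp⟩
    rcases lt_or_ge v (4 * t + 4) with h | h
    · exact .inl ⟨1, 2, by simp; omega⟩
    rcases lt_or_ge v (4 * t + 5) with h | h
    · exact .inl ⟨1, 1, by simp; omega⟩
    rcases lt_or_ge v (5 * t + 5) with h | h
    · exact .inr ⟨0, 5 * t + 4 - v, 0, by omega, by simp; omega⟩
    rcases lt_or_ge v (6 * t + 5) with h | h
    · exact .inr ⟨2, v - 5 * t - 5, 2, by omega, by simp⟩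
    rcases lt_or_ge v (7 * t + 5) with h | h
    · exact .inr ⟨0, v - 6 * t - 5, 3, by omega, by simp; omega⟩
    rcases lt_or_ge v (7 * t + 6) with h | h
    · exact .inl ⟨0, 2, by simp; omega⟩
    rcases lt_or_ge v (8 * t + 6) with h | h
    · exact .inr ⟨2, 8 * t + 5 - v, 3, by omega, by simp⟩
    rcases lt_or_ge v (9 * t + 6) with h | h
    · exact .inr ⟨0, v - 8 * t - 6, 2, by omega, by simp⟩
    rcases lt_or_ge v (9 * t + 7) with h | h
    · exact .inl ⟨0, 1, by simp; omega⟩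
    rcases lt_or_ge v (9 * t + 8) with h | h
    · exact .inl ⟨1, 0, by simp; omega⟩
    rcases lt_or_ge v (9 * t + 9) with h | h
    · exact .inl ⟨2, 0, by simp; omega⟩
    rcases lt_or_ge v (11 * t + 9) with h | h
    · rcases Int.emod_two_eq_zero_or_one (v - 9 * t - 9) with h3 | h3
      · exact .inr ⟨2, (v - 9 * t - 9) / 2, 1, by omega, by simp; omega⟩
      · exact .inr ⟨1, (11 * t + 8 - v) / 2, 2, by omega, by simp; omega⟩
    rcases lt_or_ge v (11 * t + 10) with h | h
    · exact .inl ⟨2, 1, by simp; omega⟩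
    exact .inr ⟨1, 12 * t + 9 - v, 1, by omega, by simp⟩

set_option maxHeartbeats 1000000 in
theorem exists_simpleHeffterArray_four_mul_add_four (t : ℕ) :
    ∃ H : Matrix (Fin 3) (Fin (4 * t + 4)) (ZMod (2 * 3 * (4 * t + 4) + 1)),
      IsSimpleHeffterArray H ∧
      (∀ i : Fin 3, IsSimpleOrdering fun j : Fin (4 * t + 4) => H i j) ∧
      (∀ j : Fin (4 * t + 4), IsSimpleOrdering fun i : Fin 3 => H i j) := by
  refine exists_simpleHeffterArray_of_rows (c := 3) (t := t) rfl
    ![![-3 * t - 3, -7 * t - 8, 9 * t + 9, 2 * t + 2],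
      ![-9 * t - 10, 1, 4 * t + 5, 3 * t + 4],
      ![-12 * t - 12, 7 * t + 7, 11 * t + 11, -5 * t - 6]]
    ![![0, 21 * t + 22, 14 * t + 14, 23 * t + 23],
      ![0, 15 * t + 15, 15 * t + 16, 19 * t + 21],
      ![0, 12 * t + 13, 19 * t + 20, 6 * t + 6]]
    ![fun r => ![-6 * t - 7 - r, -5 * t - 5 + r, 3 * t + 2 - r, 8 * t + 9 + r],
      fun r => ![8 * t + 8 - r, 2 * t - 2 * r, 9 * t + 12 + 2 * r, 5 * t + 7 + r],
      fun r => ![-2 * t - 1 + 2 * r, 3 * t + 5 + r, 12 * t + 11 - r, 11 * t + 9 - 2 * r]]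
    -- Here the rows gain -1, 2, -1 per block: the block starts `t - r`, `22t + 25 + 2r`, `t - r`
    -- reach `0`, `N`, `0` at `r = t`.
    ![fun r => ![t - r, 19 * t + 18 - 2 * r, 14 * t + 13 - r, 17 * t + 15 - 2 * r],
      fun r => ![22 * t + 25 + 2 * r, 6 * t + 8 + r, 8 * t + 8 - r, 17 * t + 20 + r],
      fun r => ![t - r, 23 * t + 24 + r, 2 * t + 4 + 2 * r, 14 * t + 15 + r]] ?_ ?_ ?_ ?_
  · intro i
    fin_cases i <;> constructor <;>
      simp [Fin.forall_fin_succ, IsSmallMultiple, -not_lt, -not_le] <;> omega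
  · simp [Fin.forall_fin_succ, IsSmallMultiple]; omega
  · simp [Fin.forall_fin_succ, IsSmallMultiple]; omega
  · intro v h1 h2
    rcases lt_or_ge v 2 with h | h
    · exact .inl ⟨1, 1, by simp; omega⟩
    rcases lt_or_ge v (2 * t + 2) with h | h
    · rcases Int.emod_two_eq_zero_or_one (v - 2 * t) with h3 | h3
      · exact .inr ⟨1, (2 * t - v) / 2, 1, by omega, by simp; omega⟩
      · exact .inr ⟨2, (2 * t + 1 - v) / 2, 0, by omega, by simp; omega⟩
    rcases lt_or_ge v (2 * t + 3) with h | h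
    · exact .inl ⟨0, 3, by simp; omega⟩
    rcases lt_or_ge v (3 * t + 3) with h | h
    · exact .inr ⟨0, 3 * t + 2 - v, 2, by omega, by simp⟩
    rcases lt_or_ge v (3 * t + 4) with h | h
    · exact .inl ⟨0, 0, by simp; omega⟩
    rcases lt_or_ge v (3 * t + 5) with h | h
    · exact .inl ⟨1, 3, by simp; omega⟩
    rcases lt_or_ge v (4 * t + 5) with h | h
    · exact .inr ⟨2, v - 3 * t - 5, 1, by omega, by simp⟩
    rcases lt_or_ge v (4 * t + 6) with h | h
    · exact .inl ⟨1, 2, by simp; omega⟩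
    rcases lt_or_ge v (5 * t + 6) with h | h
    · exact .inr ⟨0, 5 * t + 5 - v, 1, by omega, by simp; omega⟩
    rcases lt_or_ge v (5 * t + 7) with h | h
    · exact .inl ⟨2, 3, by simp; omega⟩
    rcases lt_or_ge v (6 * t + 7) with h | h
    · exact .inr ⟨1, v - 5 * t - 7, 3, by omega, by simp⟩
    rcases lt_or_ge v (7 * t + 7) with h | h
    · exact .inr ⟨0, v - 6 * t - 7, 0, by omega, by simp; omega⟩
    rcases lt_or_ge v (7 * t + 8) with h | h
    · exact .inl ⟨2, 1, by simp; omega⟩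
    rcases lt_or_ge v (7 * t + 9) with h | h
    · exact .inl ⟨0, 1, by simp; omega⟩
    rcases lt_or_ge v (8 * t + 9) with h | h
    · exact .inr ⟨1, 8 * t + 8 - v, 0, by omega, by simp⟩
    rcases lt_or_ge v (9 * t + 9) with h | h
    · exact .inr ⟨0, v - 8 * t - 9, 3, by omega, by simp⟩
    rcases lt_or_ge v (9 * t + 10) with h | h
    · exact .inl ⟨0, 2, by simp; omega⟩
    rcases lt_or_ge v (9 * t + 11) with h | h
    · exact .inl ⟨1, 0, by simp; omega⟩
    rcases lt_or_ge v (11 * t + 11) with h | h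
    · rcases Int.emod_two_eq_zero_or_one (v - 11 * t - 9) with h3 | h3
      · exact .inr ⟨2, (11 * t + 9 - v) / 2, 3, by omega, by simp; omega⟩
      · exact .inr ⟨1, (v - 9 * t - 12) / 2, 2, by omega, by simp; omega⟩
    rcases lt_or_ge v (11 * t + 12) with h | h
    · exact .inl ⟨2, 2, by simp; omega⟩
    rcases lt_or_ge v (12 * t + 12) with h | h
    · exact .inr ⟨2, 12 * t + 11 - v, 2, by omega, by simp⟩
    exact .inl ⟨2, 0, by simp; omega⟩

set_option maxHeartbeats 1000000 in
theorem exists_simpleHeffterArray_four_mul_add_five (t : ℕ) :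
    ∃ H : Matrix (Fin 3) (Fin (4 * t + 5)) (ZMod (2 * 3 * (4 * t + 5) + 1)),
      IsSimpleHeffterArray H ∧
      (∀ i : Fin 3, IsSimpleOrdering fun j : Fin (4 * t + 5) => H i j) ∧
      (∀ j : Fin (4 * t + 5), IsSimpleOrdering fun i : Fin 3 => H i j) := by
  refine exists_simpleHeffterArray_of_rows (c := 4) (t := t) rfl
    ![![3 * t + 5, 3 * t + 4, 8 * t + 10, -11 * t - 13, -4 * t - 6],
      ![-11 * t - 14, 8 * t + 11, -5 * t - 7, 9 * t + 12, -2 * t - 2],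
      ![8 * t + 9, -11 * t - 15, -3 * t - 3, 2 * t + 1, 6 * t + 8]]
    ![![0, 3 * t + 5, 6 * t + 9, 14 * t + 19, 3 * t + 6],
      ![0, 13 * t + 17, 21 * t + 28, 16 * t + 21, t + 2],
      ![0, 8 * t + 9, 21 * t + 25, 18 * t + 22, 20 * t + 23]]
    ![fun r => ![-3 * t - 2 + r, -8 * t - 12 - r, 6 * t + 9 + r, 5 * t + 6 - r],
      fun r => ![-9 * t - 14 - 2 * r, -5 * t - 8 - r, -8 * t - 8 + r, -2 * t + 2 * r],
      fun r => ![-12 * t - 15 + r, -11 * t - 11 + 2 * r, 2 * t - 1 - 2 * r, -3 * t - 6 - r]]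
    ![fun r => ![23 * t + 31 + r, 20 * t + 29 + 2 * r, 12 * t + 17 + r, 18 * t + 26 + 2 * r],
      fun r => ![23 * t + 31 + r, 14 * t + 17 - r, 9 * t + 9 - 2 * r, t + 1 - r],
      fun r => ![2 * t - 2 * r, 14 * t + 16 - r, 3 * t + 5 + r, 5 * t + 4 - r]] ?_ ?_ ?_ ?_
  · intro i
    fin_cases i <;> constructor <;>
      simp [Fin.forall_fin_succ, IsSmallMultiple, -not_lt, -not_le] <;> omega
  · simp [Fin.forall_fin_succ, IsSmallMultiple]; omega
  · simp [Fin.forall_fin_succ, IsSmallMultiple]; omega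
  · intro v h1 h2
    rcases lt_or_ge v (2 * t + 1) with h | h
    · rcases Int.emod_two_eq_zero_or_one (v - 2 * t + 1) with h3 | h3
      · exact .inr ⟨2, (2 * t - 1 - v) / 2, 2, by omega, by simp; omega⟩
      · exact .inr ⟨1, (2 * t - v) / 2, 3, by omega, by simp; omega⟩
    rcases lt_or_ge v (2 * t + 2) with h | h
    · exact .inl ⟨2, 3, by simp; omega⟩
    rcases lt_or_ge v (2 * t + 3) with h | h
    · exact .inl ⟨1, 4, by simp; omega⟩
    rcases lt_or_ge v (3 * t + 3) with h | h
    · exact .inr ⟨0, 3 * t + 2 - v, 0, by omega, by simp; omega⟩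
    rcases lt_or_ge v (3 * t + 4) with h | h
    · exact .inl ⟨2, 2, by simp; omega⟩
    rcases lt_or_ge v (3 * t + 5) with h | h
    · exact .inl ⟨0, 1, by simp; omega⟩
    rcases lt_or_ge v (3 * t + 6) with h | h
    · exact .inl ⟨0, 0, by simp; omega⟩
    rcases lt_or_ge v (4 * t + 6) with h | h
    · exact .inr ⟨2, v - 3 * t - 6, 3, by omega, by simp; omega⟩
    rcases lt_or_ge v (4 * t + 7) with h | h
    · exact .inl ⟨0, 4, by simp; omega⟩
    rcases lt_or_ge v (5 * t + 7) with h | h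
    · exact .inr ⟨0, 5 * t + 6 - v, 3, by omega, by simp⟩
    rcases lt_or_ge v (5 * t + 8) with h | h
    · exact .inl ⟨1, 2, by simp; omega⟩
    rcases lt_or_ge v (6 * t + 8) with h | h
    · exact .inr ⟨1, v - 5 * t - 8, 1, by omega, by simp; omega⟩
    rcases lt_or_ge v (6 * t + 9) with h | h
    · exact .inl ⟨2, 4, by simp; omega⟩
    rcases lt_or_ge v (7 * t + 9) with h | h
    · exact .inr ⟨0, v - 6 * t - 9, 2, by omega, by simp⟩
    rcases lt_or_ge v (8 * t + 9) with h | h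
    · exact .inr ⟨1, 8 * t + 8 - v, 2, by omega, by simp; omega⟩
    rcases lt_or_ge v (8 * t + 10) with h | h
    · exact .inl ⟨2, 0, by simp; omega⟩
    rcases lt_or_ge v (8 * t + 11) with h | h
    · exact .inl ⟨0, 2, by simp; omega⟩
    rcases lt_or_ge v (8 * t + 12) with h | h
    · exact .inl ⟨1, 1, by simp; omega⟩
    rcases lt_or_ge v (9 * t + 12) with h | h
    · exact .inr ⟨0, v - 8 * t - 12, 1, by omega, by simp; omega⟩
    rcases lt_or_ge v (9 * t + 13) with h | h
    · exact .inl ⟨1, 3, by simp; omega⟩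
    rcases lt_or_ge v (11 * t + 13) with h | h
    -- The values `11t + 11 - 2r` and `9t + 14 + 2r` have opposite parity and interleave to fill the
    -- interval.
    · rcases Int.emod_two_eq_zero_or_one (v - 11 * t - 11) with h3 | h3
      · exact .inr ⟨2, (11 * t + 11 - v) / 2, 1, by omega, by simp; omega⟩
      · exact .inr ⟨1, (v - 9 * t - 14) / 2, 0, by omega, by simp; omega⟩
    rcases lt_or_ge v (11 * t + 14) with h | h
    · exact .inl ⟨0, 3, by simp; omega⟩
    rcases lt_or_ge v (11 * t + 15) with h | h
    · exact .inl ⟨1, 0, by simp; omega⟩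
    rcases lt_or_ge v (11 * t + 16) with h | h
    · exact .inl ⟨2, 1, by simp; omega⟩
    exact .inr ⟨2, 12 * t + 15 - v, 0, by omega, by simp; omega⟩

set_option maxHeartbeats 1000000 in
theorem exists_simpleHeffterArray_four_mul_add_six (t : ℕ) :
    ∃ H : Matrix (Fin 3) (Fin (4 * t + 6)) (ZMod (2 * 3 * (4 * t + 6) + 1)),
      IsSimpleHeffterArray H ∧
      (∀ i : Fin 3, IsSimpleOrdering fun j : Fin (4 * t + 6) => H i j) ∧
      (∀ j : Fin (4 * t + 6), IsSimpleOrdering fun i : Fin 3 => H i j) := by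
  refine exists_simpleHeffterArray_of_rows (c := 5) (t := t) rfl
    ![![-7 * t - 12, 5 * t + 5, 8 * t + 13, 6 * t + 9, 8 * t + 14, 6 * t + 8],
      ![9 * t + 15, -2 * t - 1, -6 * t - 11, 5 * t + 7, 11 * t + 17, 6 * t + 10],
      ![-2 * t - 3, -3 * t - 4, -2 * t - 2, -11 * t - 16, 5 * t + 6, -12 * t - 18]]
    ![![0, 17 * t + 25, 22 * t + 30, 6 * t + 6, 12 * t + 15, 20 * t + 29],
      ![0, 9 * t + 15, 7 * t + 14, t + 3, 6 * t + 10, 17 * t + 27],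
      ![0, 22 * t + 34, 19 * t + 30, 17 * t + 28, 6 * t + 12, 11 * t + 18]]
    ![fun r => ![4 * t + 5 + r, -2 * t - 4 - r, 6 * t + 12 + r, -8 * t - 15 - r],
      fun r => ![-1 - 2 * r, -11 * t - 15 + 2 * r, -8 * t - 12 + r, -5 * t - 8 - r],
      fun r => ![-4 * t - 4 + r, -11 * t - 18 - r, 2 * t - 2 * r, -11 * t - 14 + 2 * r]]
    ![fun r => ![2 * t - 2 * r, 6 * t + 5 - r, 4 * t + 1 - 2 * r, 10 * t + 13 - r],
      fun r => ![23 * t + 37 + r, 23 * t + 36 - r, 12 * t + 21 + r, 4 * t + 9 + 2 * r],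
      fun r => ![23 * t + 37 + r, 19 * t + 33 + 2 * r, 8 * t + 15 + r, 10 * t + 15 - r]] ?_ ?_ ?_ ?_
  · intro i
    fin_cases i <;> constructor <;>
      simp [Fin.forall_fin_succ, IsSmallMultiple, -not_lt, -not_le] <;> omega
  · simp [Fin.forall_fin_succ, IsSmallMultiple]; omega
  · simp [Fin.forall_fin_succ, IsSmallMultiple]; omega
  · intro v h1 h2
    rcases lt_or_ge v (2 * t + 1) with h | h
    · rcases Int.emod_two_eq_zero_or_one (v - 1) with h3 | h3
      · exact .inr ⟨1, (v - 1) / 2, 0, by omega, by simp; omega⟩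
      · exact .inr ⟨2, (2 * t - v) / 2, 2, by omega, by simp; omega⟩
    rcases lt_or_ge v (2 * t + 2) with h | h
    · exact .inl ⟨1, 1, by simp; omega⟩
    rcases lt_or_ge v (2 * t + 3) with h | h
    · exact .inl ⟨2, 2, by simp; omega⟩
    rcases lt_or_ge v (2 * t + 4) with h | h
    · exact .inl ⟨2, 0, by simp; omega⟩
    rcases lt_or_ge v (3 * t + 4) with h | h
    · exact .inr ⟨0, v - 2 * t - 4, 1, by omega, by simp; omega⟩
    rcases lt_or_ge v (3 * t + 5) with h | h
    · exact .inl ⟨2, 1, by simp; omega⟩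
    rcases lt_or_ge v (4 * t + 5) with h | h
    · exact .inr ⟨2, 4 * t + 4 - v, 0, by omega, by simp; omega⟩
    rcases lt_or_ge v (5 * t + 5) with h | h
    · exact .inr ⟨0, v - 4 * t - 5, 0, by omega, by simp⟩
    rcases lt_or_ge v (5 * t + 6) with h | h
    · exact .inl ⟨0, 1, by simp; omega⟩
    rcases lt_or_ge v (5 * t + 7) with h | h
    · exact .inl ⟨2, 4, by simp; omega⟩
    rcases lt_or_ge v (5 * t + 8) with h | h
    · exact .inl ⟨1, 3, by simp; omega⟩
    rcases lt_or_ge v (6 * t + 8) with h | h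
    · exact .inr ⟨1, v - 5 * t - 8, 3, by omega, by simp; omega⟩
    rcases lt_or_ge v (6 * t + 9) with h | h
    · exact .inl ⟨0, 5, by simp; omega⟩
    rcases lt_or_ge v (6 * t + 10) with h | h
    · exact .inl ⟨0, 3, by simp; omega⟩
    rcases lt_or_ge v (6 * t + 11) with h | h
    · exact .inl ⟨1, 5, by simp; omega⟩
    rcases lt_or_ge v (6 * t + 12) with h | h
    · exact .inl ⟨1, 2, by simp; omega⟩
    rcases lt_or_ge v (7 * t + 12) with h | h
    · exact .inr ⟨0, v - 6 * t - 12, 2, by omega, by simp⟩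
    rcases lt_or_ge v (7 * t + 13) with h | h
    · exact .inl ⟨0, 0, by simp; omega⟩
    rcases lt_or_ge v (8 * t + 13) with h | h
    · exact .inr ⟨1, 8 * t + 12 - v, 2, by omega, by simp; omega⟩
    rcases lt_or_ge v (8 * t + 14) with h | h
    · exact .inl ⟨0, 2, by simp; omega⟩
    rcases lt_or_ge v (8 * t + 15) with h | h
    · exact .inl ⟨0, 4, by simp; omega⟩
    rcases lt_or_ge v (9 * t + 15) with h | h
    · exact .inr ⟨0, v - 8 * t - 15, 3, by omega, by simp; omega⟩
    rcases lt_or_ge v (9 * t + 16) with h | h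
    · exact .inl ⟨1, 0, by simp; omega⟩
    rcases lt_or_ge v (11 * t + 16) with h | h
    · rcases Int.emod_two_eq_zero_or_one (v - 11 * t - 14) with h3 | h3
      · exact .inr ⟨2, (11 * t + 14 - v) / 2, 3, by omega, by simp; omega⟩
      · exact .inr ⟨1, (11 * t + 15 - v) / 2, 1, by omega, by simp; omega⟩
    rcases lt_or_ge v (11 * t + 17) with h | h
    · exact .inl ⟨2, 3, by simp; omega⟩
    rcases lt_or_ge v (11 * t + 18) with h | h
    · exact .inl ⟨1, 4, by simp; omega⟩
    rcases lt_or_ge v (12 * t + 18) with h | h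
    · exact .inr ⟨2, v - 11 * t - 18, 1, by omega, by simp; omega⟩
    exact .inl ⟨2, 5, by simp; omega⟩

theorem mainTheorem2 (n : ℕ) (hn : 3 ≤ n) :
    ∃ H : Matrix (Fin 3) (Fin n) (ZMod (2 * 3 * n + 1)),
      IsSimpleHeffterArray H ∧
      (∀ i : Fin 3, IsSimpleOrdering fun j : Fin n => H i j) ∧
      (∀ j : Fin n, IsSimpleOrdering fun i : Fin 3 => H i j) := by
  -- The class of 2 modulo 4 starts at 6 because `n ≥ 3`. For `t = 0` the array consists of its
  -- initial columns alone.
  obtain ⟨t, rfl | rfl | rfl | rfl⟩ :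
      ∃ t, n = 4 * t + 3 ∨ n = 4 * t + 4 ∨ n = 4 * t + 5 ∨ n = 4 * t + 6 :=
    ⟨(n - 3) / 4, by omega⟩
  · exact exists_simpleHeffterArray_four_mul_add_three t
  · exact exists_simpleHeffterArray_four_mul_add_four t
  · exact exists_simpleHeffterArray_four_mul_add_five t
  · exact exists_simpleHeffterArray_four_mul_add_six t
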